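/- Let $q\in(0,1)$ and let $\kappa\in\mathbf{i}\mathbb{R}$, $\kappa\neq0$ (so $\kappa^2<0$ is real). For $g:\mathbb{Z}\to\mathbb{C}$ and $x\in\mathbb{Z}$ put $$(\mathfrak{T}^{\mathrm{ctr}}g)(x)=d(x+1)\,g(x+1)+a(x)\,g(x)+d(x)\,g(x-1),$$ where $$d(x)=\frac{-\kappa^2q^{2x+1/2}}{(1-\kappa^2q^{2x})\sqrt{(1-\kappa^2q^{2x-1})(1-\kappa^2q^{2x+1})}},\qquad a(x)=\frac{-\kappa^2(1+q)\,q^{2x+1}}{(1-\kappa^2q^{2x})(1-\kappa^2q^{2x+2})}.$$ For $n=0,1,2,\ldots$ and $x\in\mathbb{Z}$ let $$g_n(x)=q^{x(x+1)}(-\kappa^2)^x\sqrt{q^{-x}-\kappa^2q^{x+1}}\;\sum_{i=0}^{n}\kappa^{2i}q^{(2i-n)x-i(n-i-1)}\frac{(q;q)_n}{(q;q)_i(q;q)_{n-i}},\qquad (a;q)_k=\prod_{j=0}^{k-1}(1-aq^j).$$ Then $\mathfrak{T}^{\mathrm{ctr}}$ is a bounded self-adjoint operator on $\ell^2(\mathbb{Z})$.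 The functions $g_n$ are nonzero elements of $\ell^2(\mathbb{Z})$ with $\mathfrak{T}^{\mathrm{ctr}}g_n=q^{n+1}g_n$, and they form an orthogonal basis of $\ell^2(\mathbb{Z})$: they are pairwise orthogonal and their linear span is dense. Consequently $\mathfrak{T}^{\mathrm{ctr}}$ has positive spectrum in the following sense: $\langle \mathfrak{T}^{\mathrm{ctr}}f,f\rangle>0$ for all nonzero $f\in\ell^2(\mathbb{Z})$; the eigenvalues of $\mathfrak{T}^{\mathrm{ctr}}$ are exactly $q,q^2,q^3,\ldots$; and its spectrum is $\{0\}\cup\{q^{n+1}:n\ge0\}$, where the accumulation point $0$ is not an eigenvalue. -/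

import Mathlib

noncomputable section

namespace CenterLine

/-- The real number `κ²`, for `κ ∈ iℝ` (so that `κ²` is real and nonpositive). -/
def kappaSq (κ : ℂ) : ℝ := (κ ^ 2).re

/-- The `q`-Pochhammer symbol `(a;q)_k = (1 - a)(1 - aq)⋯(1 - aq^(k-1))`. -/
def qPochhammer (a q : ℝ) (k : ℕ) : ℝ := ∏ j ∈ Finset.range k, (1 - a * q ^ j)

/-- The off-diagonal Jacobi coefficient `d(x)`, `x ∈ ℤ`. -/
def dCtr (q : ℝ) (κ : ℂ) (x : ℤ) : ℝ :=
  (-kappaSq κ * q ^ (2 * (x : ℝ) + 1 / 2)) /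
    ((1 - kappaSq κ * q ^ (2 * x)) *
      Real.sqrt ((1 - kappaSq κ * q ^ (2 * x - 1)) * (1 - kappaSq κ * q ^ (2 * x + 1))))

/-- The diagonal Jacobi coefficient `a(x)`, `x ∈ ℤ`. -/
def aCtr (q : ℝ) (κ : ℂ) (x : ℤ) : ℝ :=
  (-kappaSq κ * (1 + q) * q ^ (2 * x + 1)) /
    ((1 - kappaSq κ * q ^ (2 * x)) * (1 - kappaSq κ * q ^ (2 * x + 2)))

/-- The three-term difference expression
`(𝔗 g)(x) = d(x+1) g(x+1) + a(x) g(x) + d(x) g(x-1)`, for an arbitrary function `g` on `ℤ`. -/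
def TCtr (q : ℝ) (κ : ℂ) (g : ℤ → ℂ) (x : ℤ) : ℂ :=
  (dCtr q κ (x + 1) : ℂ) * g (x + 1) + (aCtr q κ x : ℂ) * g x + (dCtr q κ x : ℂ) * g (x - 1)

/-- The functions `g_n(x)`, `n = 0, 1, 2, …`, `x ∈ ℤ` (real-valued for `κ ∈ iℝ`). -/
def gFun (q : ℝ) (κ : ℂ) (n : ℕ) (x : ℤ) : ℝ :=
  q ^ (x * (x + 1)) * (-kappaSq κ) ^ x * Real.sqrt (q ^ (-x) - kappaSq κ * q ^ (x + 1)) *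
    ∑ i ∈ Finset.range (n + 1),
      kappaSq κ ^ i * q ^ ((2 * (i : ℤ) - n) * x - i * ((n : ℤ) - i - 1)) *
        (qPochhammer q q n / (qPochhammer q q i * qPochhammer q q (n - i)))

/-- The complex Hilbert space `ℓ²(ℤ)`. -/
abbrev EllTwo : Type := lp (fun _ : ℤ => ℂ) 2

end CenterLine

end

/-! ### Positive operators of finite trace as sums of rank one operators. -/

section SumRankOne

open InnerProductSpace Filter Topology

variable {ι H : Type*} [NormedAddCommGroup H] [InnerProductSpace ℂ H] [CompleteSpace H]

/-! Write `c = -κ² > 0`. The Jacobi operator factors as `T = B* B` with `B` bidiagonal: the row of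
`B` at `x` is supported on `{x, x - 1}`, with entries `√α(x)` and `√β(x)`. In other words, `T` is
the sum of the rank one operators built from these rows. Self-adjointness, positivity and
compactness follow, since the squared norms `α(x) + β(x)` of the rows are summable.

Completeness comes from a trace count. The row norms telescope to `q / (1 - q)`
(`hasSum_alphaSq_add_betaSq`), which is exactly `∑ q^(n+1)`. The `g_n` are eigenvectors with these
eigenvalues (`TCtr_gFun`), and distinct eigenvalues make them orthogonal. They therefore use up the
whole trace, and `B` must vanish on their orthogonal complement (`inner_eq_zero_of_trace_le`). But
`B` is injective on `ℓ²(ℤ)`: solutions of the first-order recurrence `B v = 0` do not decay at `+∞`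
(`eq_zero_of_inner_rowVec`). So the complement is zero.

The eigenvalue equation reduces to a `q`-difference equation for the polynomial part of `g_n`. The
spectrum is then read off from compactness. -/

/-- The norm-convergent sum of rank one operators `∑ i, ⟪w i, ·⟫ w i`. -/
noncomputable def sumRankOne (w : ι → H) : H →L[ℂ] H := ∑' i, rankOne ℂ (w i) (w i)

variable {w : ι → H}

lemma hasSum_sumRankOne (hw : Summable fun i => ‖w i‖ ^ 2) :
    HasSum (fun i => rankOne ℂ (w i) (w i)) (sumRankOne w) := by
  refine Summable.hasSum (Summable.of_norm ?_)
  simpa [norm_rankOne, ← sq] using hw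

lemma hasSum_sumRankOne_apply (hw : Summable fun i => ‖w i‖ ^ 2) (f : H) :
    HasSum (fun i => inner ℂ (w i) f • w i) (sumRankOne w f) := by
  simpa using (ContinuousLinearMap.apply ℂ H f).hasSum (hasSum_sumRankOne hw)

lemma hasSum_inner_sumRankOne (hw : Summable fun i => ‖w i‖ ^ 2) (f h : H) :
    HasSum (fun i => inner ℂ (w i) f * inner ℂ h (w i)) (inner ℂ h (sumRankOne w f)) := by
  simpa [inner_smul_right] using (innerSL ℂ h).hasSum (hasSum_sumRankOne_apply hw f)

lemma isSelfAdjoint_sumRankOne (hw : Summable fun i => ‖w i‖ ^ 2) :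
    IsSelfAdjoint (sumRankOne w) := by
  rw [ContinuousLinearMap.isSelfAdjoint_iff_isSymmetric]
  intro f h
  have h1 := hasSum_inner_sumRankOne hw h f
  have h2 := (hasSum_inner_sumRankOne hw f h).star
  simp only [star_mul', RCLike.star_def, inner_conj_symm] at h2
  refine HasSum.unique h2 ?_
  simpa [mul_comm] using h1

/-- This is `⟪B* B f, f⟫ = ‖B f‖²`, the source of both positivity and the trace estimate. -/
lemma hasSum_re_inner_sumRankOne (hw : Summable fun i => ‖w i‖ ^ 2) (f : H) :
    HasSum (fun i => ‖inner ℂ (w i) f‖ ^ 2) (inner ℂ (sumRankOne w f) f).re := by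
  have h2 := Complex.hasSum_re (hasSum_inner_sumRankOne hw f f)
  have h3 : (inner ℂ (sumRankOne w f) f).re = (inner ℂ f (sumRankOne w f)).re := by
    rw [← inner_conj_symm, Complex.conj_re]
  rw [h3]
  refine h2.congr_fun ?_
  intro i
  rw [← inner_conj_symm f (w i), Complex.mul_conj, Complex.normSq_eq_norm_sq, Complex.ofReal_re]

lemma isCompactOperator_sumRankOne (hw : Summable fun i => ‖w i‖ ^ 2) :
    IsCompactOperator (sumRankOne w) := by
  refine isCompactOperator_of_tendsto (hasSum_sumRankOne hw) (Eventually.of_forall fun s => ?_)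
  have hmem : ∀ i ∈ s, rankOne ℂ (w i) (w i) ∈ compactOperator (RingHom.id ℂ) H H := by
    intro i _
    change IsCompactOperator (rankOne ℂ (w i) (w i))
    exact (isCompactOperator_of_locallyCompactSpace_dom (innerSL ℂ (w i))).clm_comp
      (ContinuousLinearMap.toSpanSingleton ℂ (w i))
  exact Submodule.sum_mem _ hmem

/-- If the eigenvalues on an orthonormal sequence of eigenvectors exhaust the trace, the operator
vanishes on the orthogonal complement. -/
lemma inner_eq_zero_of_trace_le (hw : Summable fun i => ‖w i‖ ^ 2) {e : ℕ → H}
    (he : Orthonormal ℂ e) {l : ℕ → ℝ} (hl : ∀ n, sumRankOne w (e n) = (l n : ℂ) • e n)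
    {τ : ℝ} (hsum : HasSum l τ) (hτ : ∑' i, ‖w i‖ ^ 2 ≤ τ) {v : H}
    (hv : ∀ n, inner ℂ (e n) v = 0) (i : ι) : inner ℂ (w i) v = 0 := by
  by_cases hv0 : v = 0
  · simp [hv0]
  have hnv : ‖v‖ ≠ 0 := by simpa using hv0
  set u : H := (‖v‖⁻¹ : ℂ) • v with hu
  have hu1 : ‖u‖ = 1 := by rw [hu, norm_smul]; simp [hnv]
  have hue : ∀ n, inner ℂ (e n) u = 0 := fun n => by simp [hu, hv]
  have hue' : ∀ n, inner ℂ u (e n) = 0 := fun n => by rw [← inner_conj_symm, hue]; simp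
  -- Adjoin the unit vector `u` to the sequence and apply Bessel's inequality to each `w i`; summing
  -- over `i` leaves no room for `⟪T u, u⟫` once the eigenvalues fill the trace.
  have hon : Orthonormal ℂ (fun o : Option ℕ => o.elim u e) := by
    constructor
    · rintro (_ | n)
      · exact hu1
      · exact he.1 n
    · rintro (_ | m) (_ | n) hmn
      · exact absurd rfl hmn
      · exact hue' n
      · exact hue m
      · exact he.2 (by simpa using hmn)
  have key : ∀ N : ℕ, ∑ n ∈ Finset.range N, l n + (inner ℂ (sumRankOne w u) u).re
      ≤ ∑' i, ‖w i‖ ^ 2 := by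
    intro N
    have hs : HasSum (fun i => ∑ n ∈ Finset.range N, ‖inner ℂ (w i) (e n)‖ ^ 2
        + ‖inner ℂ (w i) u‖ ^ 2)
        (∑ n ∈ Finset.range N, l n + (inner ℂ (sumRankOne w u) u).re) := by
      refine (hasSum_sum fun n _ => ?_).add (hasSum_re_inner_sumRankOne hw u)
      have := hasSum_re_inner_sumRankOne hw (e n)
      rwa [hl, inner_smul_left, inner_self_eq_norm_sq_to_K, he.1 n, Complex.conj_ofReal,
        RCLike.ofReal_one, one_pow, mul_one, Complex.ofReal_re] at this
    refine hasSum_le (fun i => ?_) hs hw.hasSum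
    have := hon.sum_inner_products_le (w i)
      (s := (Finset.range N).insertNone)
    rw [Finset.sum_insertNone] at this
    simp only [Option.elim] at this
    simp_rw [norm_inner_symm (w i)]
    linarith
  have hlim := le_of_tendsto' (hsum.tendsto_sum_nat.add_const _) key
  have hz := hasSum_re_inner_sumRankOne hw u
  have hnn : 0 ≤ (inner ℂ (sumRankOne w u) u).re := hz.nonneg fun _ => by positivity
  have h0 : (inner ℂ (sumRankOne w u) u).re = 0 := by linarith
  rw [h0, hasSum_zero_iff_of_nonneg (fun _ => by positivity)] at hz
  have := congrFun hz i
  simpa [hu, inner_smul_right, hnv, hv0] using this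

end SumRankOne

/-! ### The bidiagonal factorization: trace, matrix entries and injectivity. -/

noncomputable section

namespace CenterLine

open Filter Topology

/-- Square of the diagonal entry of the bidiagonal factor of `𝔗`, with `c = -κ²`. -/
def alphaSq (q c : ℝ) (x : ℤ) : ℝ :=
  c * q ^ (2 * x + 1) / ((1 + c * q ^ (2 * x)) * (1 + c * q ^ (2 * x + 1)))

/-- Square of the off-diagonal entry of the bidiagonal factor of `𝔗`, with `c = -κ²`. -/
def betaSq (q c : ℝ) (x : ℤ) : ℝ :=
  c * q ^ (2 * x) / ((1 + c * q ^ (2 * x)) * (1 + c * q ^ (2 * x - 1)))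

/-- The rows of the bidiagonal factor of `𝔗`. -/
def rowVec (q c : ℝ) (x : ℤ) : EllTwo :=
  lp.single 2 x ((√(alphaSq q c x) : ℝ) : ℂ) + lp.single 2 (x - 1) ((√(betaSq q c x) : ℝ) : ℂ)

variable {q c : ℝ}

lemma alphaSq_pos (hq : 0 < q) (hc : 0 < c) (x : ℤ) : 0 < alphaSq q c x := by
  unfold alphaSq; positivity

lemma betaSq_pos (hq : 0 < q) (hc : 0 < c) (x : ℤ) : 0 < betaSq q c x := by
  unfold betaSq; positivity

lemma inner_rowVec (x : ℤ) (f : EllTwo) :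
    inner ℂ (rowVec q c x) f = (√(alphaSq q c x) : ℝ) * f x + (√(betaSq q c x) : ℝ) * f (x - 1) := by
  simp [rowVec, lp.inner_single_left, mul_comm]

lemma rowVec_apply_self (x : ℤ) : rowVec q c x x = (√(alphaSq q c x) : ℝ) := by
  simp [rowVec, lp.single_apply]

lemma rowVec_apply_sub_one (x : ℤ) : rowVec q c x (x - 1) = (√(betaSq q c x) : ℝ) := by
  simp [rowVec, lp.single_apply]

lemma rowVec_apply_of_ne {x y : ℤ} (h1 : x ≠ y) (h2 : x ≠ y + 1) : rowVec q c x y = 0 := by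
  have : y ≠ x - 1 := by omega
  simp [rowVec, lp.single_apply, h1.symm, this]

lemma norm_sq_rowVec (hq : 0 < q) (hc : 0 < c) (x : ℤ) :
    ‖rowVec q c x‖ ^ 2 = alphaSq q c x + betaSq q c x := by
  have h := inner_self_eq_norm_sq_to_K (𝕜 := ℂ) (rowVec q c x)
  rw [inner_rowVec, rowVec_apply_self, rowVec_apply_sub_one] at h
  have ha := Real.mul_self_sqrt (alphaSq_pos hq hc x).le
  have hb := Real.mul_self_sqrt (betaSq_pos hq hc x).le
  have h' : ((√(alphaSq q c x) * √(alphaSq q c x) + √(betaSq q c x) * √(betaSq q c x) : ℝ) : ℂ)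
      = ((‖rowVec q c x‖ ^ 2 : ℝ) : ℂ) := by
    push_cast
    exact h
  rw [ha, hb] at h'
  exact_mod_cast h'.symm

/-- The telescoping form of the squared row norm; the function being differenced tends to `1` at
`+∞` and to `0` at `-∞`, so the total is `q / (1 - q)`. -/
lemma alphaSq_add_betaSq (hq : 0 < q) (hq1 : q < 1) (hc : 0 < c) (x : ℤ) :
    alphaSq q c x + betaSq q c x
      = q / (1 - q) * ((1 + c * q ^ (2 * (x + 1) - 1))⁻¹ - (1 + c * q ^ (2 * x - 1))⁻¹) := by
  have h1 : 2 * (x + 1) - 1 = 2 * x + 1 := by ring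
  have hq0 := hq.ne'
  have h1q : 1 - q ≠ 0 := by linarith
  unfold alphaSq betaSq
  rw [h1, zpow_add₀ hq0, zpow_sub₀ hq0, zpow_one]
  have hQ : 0 < q ^ (2 * x) := by positivity
  generalize q ^ (2 * x) = Q at *
  have e1 : 1 + c * Q ≠ 0 := by positivity
  have e2 : 1 + c * (Q * q) ≠ 0 := by positivity
  have e3 : 1 + c * (Q / q) ≠ 0 := by positivity
  have e4 : q + c * Q ≠ 0 := by positivity
  field_simp
  ring

lemma hasSum_alphaSq_add_betaSq (hq : 0 < q) (hq1 : q < 1) (hc : 0 < c) :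
    HasSum (fun x : ℤ => alphaSq q c x + betaSq q c x) (q / (1 - q)) := by
  set F : ℤ → ℝ := fun x => (1 + c * q ^ (2 * x - 1))⁻¹ with hF
  have hq0 := hq.ne'
  have h2 : Tendsto (fun n : ℕ => (q ^ 2) ^ n) atTop (𝓝 0) :=
    tendsto_pow_atTop_nhds_zero_of_lt_one (by positivity) (by nlinarith)
  have hF1 : Tendsto (fun n : ℕ => F n) atTop (𝓝 1) := by
    have : Tendsto (fun n : ℕ => (1 + c * ((q ^ 2) ^ n / q))⁻¹) atTop (𝓝 (1 + c * (0 / q))⁻¹) :=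
      (((h2.div_const q).const_mul c).const_add 1).inv₀ (by simp)
    simp only [zero_div, mul_zero, add_zero, inv_one] at this
    refine this.congr fun n => ?_
    simp only [hF]
    rw [zpow_sub₀ hq0, zpow_mul, zpow_natCast, zpow_one]
    norm_cast
  have hF0 : Tendsto (fun n : ℕ => F (-n)) atTop (𝓝 0) := by
    have : Tendsto (fun n : ℕ => (q ^ 2) ^ n / ((q ^ 2) ^ n + c / q)) atTop (𝓝 (0 / (0 + c / q))) :=
      h2.div (h2.add_const _) (by positivity)
    rw [zero_div] at this
    refine this.congr fun n => ?_
    simp only [hF]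
    rw [zpow_sub₀ hq0, zpow_mul, zpow_neg, zpow_natCast, zpow_one]
    have : (q ^ (2 : ℤ)) = q ^ 2 := by norm_cast
    rw [this]
    have : 0 < (q ^ 2) ^ n := by positivity
    generalize (q ^ 2) ^ n = Q at *
    field_simp
  have hpos : ∀ x, 0 ≤ alphaSq q c x + betaSq q c x := fun x =>
    (add_pos (alphaSq_pos hq hc x) (betaSq_pos hq hc x)).le
  have hA : HasSum (fun n : ℕ => alphaSq q c n + betaSq q c n) (q / (1 - q) * (1 - F 0)) := by
    rw [hasSum_iff_tendsto_nat_of_nonneg (fun _ => hpos _)]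
    refine ((hF1.sub_const (F 0)).const_mul (q / (1 - q))).congr fun N => ?_
    have := Finset.sum_range_sub (fun n : ℕ => F n) N
    simp only [Nat.cast_zero] at this
    rw [← this, Finset.mul_sum]
    refine Finset.sum_congr rfl fun n _ => ?_
    rw [alphaSq_add_betaSq hq hq1 hc]
    simp [hF]
  have hB : HasSum (fun n : ℕ => alphaSq q c (-(n + 1)) + betaSq q c (-(n + 1)))
      (q / (1 - q) * (F 0 - 0)) := by
    rw [hasSum_iff_tendsto_nat_of_nonneg (fun _ => hpos _)]
    refine ((hF0.const_sub (F 0)).const_mul (q / (1 - q))).congr fun N => ?_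
    have := Finset.sum_range_sub' (fun n : ℕ => F (-n)) N
    simp only [Nat.cast_zero, neg_zero] at this
    rw [← this, Finset.mul_sum]
    refine Finset.sum_congr rfl fun n _ => ?_
    rw [alphaSq_add_betaSq hq hq1 hc]
    simp [hF]
  have := HasSum.of_nat_of_neg_add_one (f := fun x : ℤ => alphaSq q c x + betaSq q c x) hA hB
  convert this using 1
  ring

/-- The off-diagonal entry of `B* B`: only the row at `x` meets both columns `x` and `x - 1`. -/
lemma sqrt_alphaSq_mul_sqrt_betaSq (hq : 0 < q) {κ : ℂ} (hc : 0 < -kappaSq κ) (x : ℤ) :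
    √(alphaSq q (-kappaSq κ) x) * √(betaSq q (-kappaSq κ) x) = dCtr q κ x := by
  rw [← Real.sqrt_mul (alphaSq_pos hq hc x).le]
  have hK : kappaSq κ = -(-kappaSq κ) := by ring
  unfold dCtr
  rw [hK]
  generalize -kappaSq κ = c at *
  have hq0 := hq.ne'
  have hr : q ^ (2 * (x : ℝ) + 1 / 2) = q ^ (2 * x) * √q := by
    rw [Real.rpow_add hq, ← Real.sqrt_eq_rpow, ← Real.rpow_intCast]
    push_cast
    rfl
  unfold alphaSq betaSq
  rw [hr]
  simp only [neg_neg, neg_mul, sub_neg_eq_add]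
  rw [zpow_add₀ hq0, zpow_sub₀ hq0, zpow_one]
  have hQ : 0 < q ^ (2 * x) := by positivity
  generalize q ^ (2 * x) = Q at *
  rw [Real.sqrt_eq_iff_mul_self_eq_of_pos (by positivity)]
  rw [div_mul_div_comm, div_mul_div_comm]
  have e : √((1 + c * (Q / q)) * (1 + c * (Q * q))) * √((1 + c * (Q / q)) * (1 + c * (Q * q)))
      = (1 + c * (Q / q)) * (1 + c * (Q * q)) := Real.mul_self_sqrt (by positivity)
  congr 1
  · linear_combination (c * Q) ^ 2 * Real.mul_self_sqrt hq.le
  · linear_combination (1 + c * Q) ^ 2 * e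

/-- The diagonal entry of `B* B` is a squared column norm, hence the shift in `β`, in contrast to
the row norms above. -/
lemma alphaSq_add_betaSq_add_one (hq : 0 < q) {κ : ℂ} (hc : 0 < -kappaSq κ) (x : ℤ) :
    alphaSq q (-kappaSq κ) x + betaSq q (-kappaSq κ) (x + 1) = aCtr q κ x := by
  have hK : kappaSq κ = -(-kappaSq κ) := by ring
  unfold aCtr
  rw [hK]
  generalize -kappaSq κ = c at *
  have hq0 := hq.ne'
  unfold alphaSq betaSq
  have h1 : 2 * (x + 1) - 1 = 2 * x + 1 := by ring
  have e1 : q ^ (2 * x + 1) = q ^ (2 * x) * q := zpow_add_one₀ hq0 _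
  have e2 : q ^ (2 * x + 2) = q ^ (2 * x) * q ^ 2 := zpow_add₀ hq0 _ 2
  have e3 : q ^ (2 * (x + 1)) = q ^ (2 * x) * q ^ 2 := by rw [← e2]; ring_nf
  simp only [neg_neg, neg_mul, sub_neg_eq_add]
  rw [h1, e1, e2, e3]
  have hQ : 0 < q ^ (2 * x) := by positivity
  generalize q ^ (2 * x) = Q at *
  field_simp
  ring

lemma summable_norm_sq_rowVec (hq : 0 < q) (hq1 : q < 1) (hc : 0 < c) :
    Summable fun x => ‖rowVec q c x‖ ^ 2 := by
  simp_rw [norm_sq_rowVec hq hc]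
  exact (hasSum_alphaSq_add_betaSq hq hq1 hc).summable

lemma sumRankOne_rowVec_apply (hq : 0 < q) (hq1 : q < 1) {κ : ℂ} (hc : 0 < -kappaSq κ)
    (f : EllTwo) (x : ℤ) :
    sumRankOne (rowVec q (-kappaSq κ)) f x = TCtr q κ (fun y => f y) x := by
  have h := hasSum_inner_sumRankOne (summable_norm_sq_rowVec hq hq1 hc) f (lp.single 2 x (1 : ℂ))
  simp only [lp.inner_single_left, RCLike.inner_apply, map_one, mul_one] at h
  have h' : HasSum (fun i => inner ℂ (rowVec q (-kappaSq κ) i) f * rowVec q (-kappaSq κ) i x)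
      (∑ i ∈ {x, x + 1}, inner ℂ (rowVec q (-kappaSq κ) i) f * rowVec q (-kappaSq κ) i x) :=
    hasSum_sum_of_ne_finset_zero (fun i hi => by
      simp only [Finset.mem_insert, Finset.mem_singleton, not_or] at hi
      rw [rowVec_apply_of_ne hi.1 hi.2, mul_zero])
  rw [h.unique h', Finset.sum_pair (by omega), rowVec_apply_self, inner_rowVec, inner_rowVec]
  have h2 := rowVec_apply_sub_one (q := q) (c := -kappaSq κ) (x + 1)
  rw [add_sub_cancel_right] at h2
  rw [h2, add_sub_cancel_right, TCtr, ← sqrt_alphaSq_mul_sqrt_betaSq hq hc,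
    ← sqrt_alphaSq_mul_sqrt_betaSq hq hc, ← alphaSq_add_betaSq_add_one hq hc]
  have ha := congrArg Complex.ofReal (Real.mul_self_sqrt (alphaSq_pos hq hc x).le)
  have hb := congrArg Complex.ofReal (Real.mul_self_sqrt (betaSq_pos hq hc (x + 1)).le)
  push_cast at ha hb ⊢
  linear_combination f x * ha + f x * hb

/-- The kernel equation determines `|v(x)|` from `|v(x - 1)|`, and its solutions are explicit:
`|v(x)|²` is a constant times `q^(-x) (1 + c q^(2x+1))`, which is not summable at `+∞` unless the
constant is `0`. -/
lemma eq_zero_of_inner_rowVec (hq : 0 < q) (hq1 : q < 1) (hc : 0 < c) {v : EllTwo}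
    (hv : ∀ x, inner ℂ (rowVec q c x) v = 0) : v = 0 := by
  have hq0 := hq.ne'
  -- The quantity conserved by the recurrence.
  set G : ℤ → ℝ := fun x => ‖v x‖ ^ 2 * q ^ x / (1 + c * q ^ (2 * x + 1)) with hG
  have hden : ∀ x : ℤ, 0 < 1 + c * q ^ (2 * x + 1) := fun x => by positivity
  have hstep : ∀ x, G x = G (x - 1) := by
    intro x
    have h := hv x
    rw [inner_rowVec, add_eq_zero_iff_eq_neg] at h
    have h' := congrArg (fun z => ‖z‖ ^ 2) h
    simp only [norm_neg, norm_mul, mul_pow, Complex.norm_real, Real.norm_eq_abs, sq_abs,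
      Real.sq_sqrt (alphaSq_pos hq hc x).le, Real.sq_sqrt (betaSq_pos hq hc x).le] at h'
    simp only [hG]
    have h1 : 2 * (x - 1) + 1 = 2 * x - 1 := by ring
    unfold alphaSq betaSq at h'
    rw [h1]
    rw [zpow_add₀ hq0 (2 * x), zpow_sub₀ hq0 (2 * x), zpow_one] at *
    rw [zpow_sub₀ hq0, zpow_one]
    have hQ : 0 < q ^ (2 * x) := by positivity
    generalize q ^ (2 * x) = Q at *
    have hR : 0 < q ^ x := by positivity
    generalize q ^ x = R at *
    have e2 : 1 + c * (Q * q) ≠ 0 := by positivity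
    have e3 : 1 + c * (Q / q) ≠ 0 := by positivity
    have e1 : 1 + c * Q ≠ 0 := by positivity
    have e4 : q + c * Q ≠ 0 := by positivity
    field_simp at h' ⊢
    linear_combination h'
  have hconst : ∀ x, G x = G 0 := by
    intro x
    induction x using Int.induction_on with
    | zero => rfl
    | succ n ih => rw [hstep, add_sub_cancel_right, ih]
    | pred n ih => rw [← hstep, ih]
  have hval : ∀ x, ‖v x‖ ^ 2 * q ^ x = G 0 * (1 + c * q ^ (2 * x + 1)) := by
    intro x
    rw [← hconst x, hG]
    exact (div_mul_cancel₀ _ (hden x).ne').symm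
  have hG0 : 0 ≤ G 0 := by simp only [hG]; positivity
  have hle : ∀ n : ℕ, G 0 ≤ ‖v n‖ ^ 2 := by
    intro n
    have h := hval n
    have h1 : q ^ (n : ℤ) ≤ 1 := by rw [zpow_natCast]; exact pow_le_one₀ hq.le hq1.le
    have h2 : 0 ≤ c * q ^ (2 * (n : ℤ) + 1) := by positivity
    nlinarith [sq_nonneg ‖v n‖]
  have hs : Summable fun x : ℤ => ‖v x‖ ^ 2 := by
    simpa using (lp.memℓp v).summable (by norm_num)
  have hlim : Tendsto (fun n : ℕ => ‖v n‖ ^ 2) atTop (𝓝 0) :=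
    (hs.comp_injective Nat.cast_injective).tendsto_atTop_zero
  have hG1 : G 0 = 0 := le_antisymm (ge_of_tendsto' hlim hle) hG0
  ext x
  have h := hval x
  rw [hG1, zero_mul] at h
  have : q ^ x ≠ 0 := by positivity
  simpa [this] using h

end CenterLine
end

/-! ### The `q`-difference equations of the polynomial part. -/

noncomputable section

namespace CenterLine

open Filter Topology

variable {q c : ℝ}

/-- The coefficients of the polynomial part of `gFun`. -/
def polyCoeff (q : ℝ) (n i : ℕ) : ℝ :=
  (-1) ^ i * q ^ (-(i * ((n : ℤ) - i - 1))) *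
    (qPochhammer q q n / (qPochhammer q q i * qPochhammer q q (n - i)))

/-- The polynomial part of `gFun`, a `q⁻¹`-Hermite polynomial in the variable `z = c q^(2x)`. -/
def polyPart (q : ℝ) (n : ℕ) (z : ℝ) : ℝ := ∑ i ∈ Finset.range (n + 1), polyCoeff q n i * z ^ i

lemma qPochhammer_pos (hq : 0 < q) (hq1 : q < 1) (k : ℕ) : 0 < qPochhammer q q k := by
  refine Finset.prod_pos fun j _ => ?_
  have : q ^ (j + 1) < 1 := pow_lt_one₀ hq.le hq1 (by omega)
  rw [pow_succ'] at this
  linarith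

lemma qPochhammer_succ (k : ℕ) :
    qPochhammer q q (k + 1) = qPochhammer q q k * (1 - q ^ (k + 1)) := by
  rw [qPochhammer, Finset.prod_range_succ, pow_succ', qPochhammer]

lemma polyCoeff_zero (hq : 0 < q) (hq1 : q < 1) (n : ℕ) : polyCoeff q n 0 = 1 := by
  have := (qPochhammer_pos hq hq1 n).ne'
  have h0 : qPochhammer q q 0 = 1 := by simp [qPochhammer]
  simp [polyCoeff, h0, this]

lemma polyCoeff_succ (hq : 0 < q) (hq1 : q < 1) {n i : ℕ} (hi : i < n) :
    polyCoeff q n (i + 1) * (1 - q ^ (i + 1)) =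
      -(q ^ (2 * (i : ℤ) + 2 - n) - q ^ (i + 2)) * polyCoeff q n i := by
  have hq0 := hq.ne'
  obtain ⟨m, rfl⟩ : ∃ m, n = i + m + 1 := ⟨n - i - 1, by omega⟩
  have s1 : i + m + 1 - (i + 1) = m := by omega
  have s2 : i + m + 1 - i = m + 1 := by omega
  unfold polyCoeff
  rw [s1, s2, qPochhammer_succ i, qPochhammer_succ m]
  have hm : q ^ (m + 1) < 1 := pow_lt_one₀ hq.le hq1 (by omega)
  have hi' : q ^ (i + 1) < 1 := pow_lt_one₀ hq.le hq1 (by omega)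
  have p1 := (qPochhammer_pos hq hq1 i).ne'
  have p2 := (qPochhammer_pos hq hq1 m).ne'
  have d1 : 1 - q ^ (m + 1) ≠ 0 := by linarith
  have d2 : 1 - q ^ (i + 1) ≠ 0 := by linarith
  have x1 : q ^ (2 * (i : ℤ) + 2 - (i + m + 1 : ℕ)) - q ^ (i + 2)
      = q ^ ((i : ℤ) + 1 - m) * (1 - q ^ (m + 1)) := by
    rw [mul_sub, mul_one, ← zpow_natCast q (m + 1), ← zpow_add₀ hq0, ← zpow_natCast]
    push_cast
    ring_nf
  have x2 : q ^ (-(((i + 1 : ℕ) : ℤ) * (((i + m + 1 : ℕ) : ℤ) - ((i + 1 : ℕ) : ℤ) - 1)))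
      = q ^ (-((i : ℤ) * (((i + m + 1 : ℕ) : ℤ) - i - 1))) * q ^ ((i : ℤ) + 1 - m) := by
    rw [← zpow_add₀ hq0]
    congr 1
    push_cast
    ring
  rw [x1, x2]
  generalize q ^ (-((i : ℤ) * (((i + m + 1 : ℕ) : ℤ) - i - 1))) = A
  generalize q ^ ((i : ℤ) + 1 - m) = B
  generalize qPochhammer q q (i + m + 1) = N
  rw [pow_succ]
  field_simp

/-- The first-order recurrence of the coefficients as a `q`-difference equation. -/
lemma polyPart_qDifference (hq : 0 < q) (hq1 : q < 1) (n : ℕ) (z : ℝ) :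
    polyPart q n z
      = (1 + q ^ 2 * z) * polyPart q n (q * z) - q ^ (2 - (n : ℤ)) * z * polyPart q n (q ^ 2 * z) := by
  have hq0 := hq.ne'
  have hL : polyPart q n z - polyPart q n (q * z)
      = ∑ i ∈ Finset.range n, polyCoeff q n (i + 1) * (1 - q ^ (i + 1)) * z ^ (i + 1) := by
    unfold polyPart
    rw [← Finset.sum_sub_distrib, Finset.sum_range_succ']
    simp only [pow_zero, mul_one, sub_self, add_zero]
    refine Finset.sum_congr rfl fun i _ => ?_
    rw [mul_pow]
    ring
  have hR : q ^ 2 * z * polyPart q n (q * z) - q ^ (2 - (n : ℤ)) * z * polyPart q n (q ^ 2 * z)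
      = ∑ i ∈ Finset.range n,
        -(q ^ (2 * (i : ℤ) + 2 - n) - q ^ (i + 2)) * polyCoeff q n i * z ^ (i + 1) := by
    have hterm : ∀ i : ℕ, q ^ (2 * (i : ℤ) + 2 - n) = q ^ (2 - (n : ℤ)) * (q ^ 2) ^ i := by
      intro i
      rw [← pow_mul, ← zpow_natCast q (2 * i), ← zpow_add₀ hq0]
      congr 1
      push_cast
      ring
    -- The recurrence factor vanishes at `i = n`, so the sum extends to the full range of the
    -- polynomial.
    have hlast : q ^ (2 * (n : ℤ) + 2 - n) - q ^ (n + 2) = 0 := by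
      rw [← zpow_natCast q (n + 2), sub_eq_zero]
      congr 1
      push_cast
      ring
    have hext : ∑ i ∈ Finset.range n,
        -(q ^ (2 * (i : ℤ) + 2 - n) - q ^ (i + 2)) * polyCoeff q n i * z ^ (i + 1)
        = ∑ i ∈ Finset.range (n + 1),
        -(q ^ (2 * (i : ℤ) + 2 - n) - q ^ (i + 2)) * polyCoeff q n i * z ^ (i + 1) := by
      rw [Finset.sum_range_succ, hlast]
      ring
    rw [hext]
    unfold polyPart
    rw [Finset.mul_sum, Finset.mul_sum, ← Finset.sum_sub_distrib]
    refine Finset.sum_congr rfl fun i _ => ?_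
    rw [hterm, mul_pow, mul_pow]
    ring
  have hLR : polyPart q n z - polyPart q n (q * z)
      = q ^ 2 * z * polyPart q n (q * z) - q ^ (2 - (n : ℤ)) * z * polyPart q n (q ^ 2 * z) := by
    rw [hL, hR]
    refine Finset.sum_congr rfl fun i hi => ?_
    rw [polyCoeff_succ hq hq1 (Finset.mem_range.mp hi)]
  linear_combination hLR

/-- The second-order equation behind the eigenvalue equation. -/
lemma polyPart_qDifference_sq (hq : 0 < q) (hq1 : q < 1) (n : ℕ) (z : ℝ) :
    z ^ 2 * q ^ 4 * (1 + z) * polyPart q n (q ^ 2 * z)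
      + z * q * (1 + q) * (1 + z * q) * q ^ n * polyPart q n z
      + q * (1 + z * q ^ 2) * (q ^ n) ^ 2 * polyPart q n (z / q ^ 2)
      = q ^ (n + 1) * (1 + z) * (1 + z * q) * (1 + z * q ^ 2) * q ^ n * polyPart q n z := by
  have hq0 := hq.ne'
  -- A step in `x` multiplies `z` by `q^(±2)`, whereas the first-order recurrence also involves `q
  -- z`. Its instances at `z`, `z/q` and `z/q²` allow the values at `q z` and `z/q` to be
  -- eliminated.
  have r1 := polyPart_qDifference hq hq1 n z
  have r2 := polyPart_qDifference hq hq1 n (z / q)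
  have r3 := polyPart_qDifference hq hq1 n (z / q ^ 2)
  have a1 : q * (z / q) = z := by field_simp
  have a2 : q ^ 2 * (z / q) = q * z := by field_simp
  have a3 : q * (z / q ^ 2) = z / q := by field_simp
  have a4 : q ^ 2 * (z / q ^ 2) = z := by field_simp
  have hz : q ^ (2 - (n : ℤ)) = q ^ 2 / q ^ n := by
    rw [zpow_sub₀ hq0, zpow_natCast]; rfl
  rw [a1, a2, hz] at r2
  rw [a3, a4, hz] at r3
  rw [hz] at r1
  have hN : q ^ n ≠ 0 := by positivity
  rw [pow_succ q n]
  generalize q ^ n = N at *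
  generalize polyPart q n (q ^ 2 * z) = P2 at *
  generalize polyPart q n (q * z) = P1 at *
  generalize polyPart q n (z / q ^ 2) = M2 at *
  generalize polyPart q n (z / q) = M1 at *
  generalize polyPart q n z = P0 at *
  rw [r3, r2]
  field_simp at r1 ⊢
  linear_combination (1 + z) * z * q * r1

end CenterLine
end

/-! ### The functions `g_n`: square summability, eigenvalue equation, nonvanishing. -/

noncomputable section

namespace CenterLine

open Filter Topology

variable {q c : ℝ}

lemma summable_pow_sq_mul_pow (hq : 0 < q) (hq1 : q < 1) {b : ℝ} (hb : 0 < b) :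
    Summable fun k : ℕ => q ^ (2 * k ^ 2) * b ^ k := by
  refine summable_of_ratio_test_tendsto_lt_one (l := 0) one_pos
    (Eventually.of_forall fun k => by positivity) ?_
  have h4 : Tendsto (fun k : ℕ => (q ^ 4) ^ k * (q ^ 2 * b)) atTop (𝓝 (0 * (q ^ 2 * b))) :=
    (tendsto_pow_atTop_nhds_zero_of_lt_one (by positivity)
      (pow_lt_one₀ hq.le hq1 (by norm_num))).mul_const _
  rw [zero_mul] at h4
  refine h4.congr fun k => ?_
  have e : q ^ (2 * (k + 1) ^ 2) = q ^ (2 * k ^ 2) * ((q ^ 4) ^ k * q ^ 2) := by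
    rw [← pow_mul, ← pow_add, ← pow_add]
    ring_nf
  rw [Real.norm_of_nonneg (by positivity), Real.norm_of_nonneg (by positivity), e, pow_succ b]
  have : q ^ (2 * k ^ 2) ≠ 0 := by positivity
  field_simp

lemma summable_zpow_sq_mul_zpow (hq : 0 < q) (hq1 : q < 1) {b : ℝ} (hb : 0 < b) :
    Summable fun x : ℤ => q ^ (2 * x ^ 2) * b ^ x := by
  refine Summable.of_nat_of_neg ?_ ?_
  · refine (summable_pow_sq_mul_pow hq hq1 hb).congr fun k => ?_
    rw [zpow_natCast, ← zpow_natCast q]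
    push_cast
    rfl
  · refine (summable_pow_sq_mul_pow hq hq1 (inv_pos.mpr hb)).congr fun k => ?_
    rw [zpow_neg, zpow_natCast, neg_sq, inv_pow, ← zpow_natCast q]
    push_cast
    rfl

lemma memℓp_weight (hq : 0 < q) (hq1 : q < 1) (hc : 0 < c) (m : ℤ) :
    Memℓp (fun x : ℤ => ((q ^ (x * (x + 1)) * c ^ x * √(q ^ (-x) + c * q ^ (x + 1)) * q ^ (m * x) : ℝ)
      : ℂ)) 2 := by
  have hq0 := hq.ne'
  have hc0 := hc.ne'
  rw [memℓp_gen_iff (by norm_num)]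
  -- The squared weight splits along the two terms under the square root; each is a Gaussian
  -- `q^(2x²)` times a geometric factor, whose base is `b`.
  have s1 := summable_zpow_sq_mul_zpow hq hq1 (b := c ^ 2 * q ^ (2 * m + 1)) (by positivity)
  have s2 := (summable_zpow_sq_mul_zpow hq hq1 (b := c ^ 2 * q ^ (2 * m + 3)) (by positivity)).mul_left
    (c * q)
  refine (s1.add s2).congr fun x => ?_
  rw [Complex.norm_real, ENNReal.toReal_ofNat, Real.rpow_two, Real.norm_eq_abs, sq_abs, mul_pow,
    mul_pow, mul_pow, Real.sq_sqrt (by positivity), mul_zpow, mul_zpow, ← zpow_mul,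
    ← zpow_mul, ← zpow_natCast (c ^ x), ← zpow_natCast (q ^ (x * (x + 1))),
    ← zpow_natCast (q ^ (m * x)), ← zpow_mul, ← zpow_mul, ← zpow_mul]
  have e1 : q ^ (2 * x ^ 2) * q ^ ((2 * m + 1) * x)
      = q ^ (x * (x + 1) * (2 : ℕ)) * q ^ (m * x * (2 : ℕ)) * q ^ (-x) := by
    rw [← zpow_add₀ hq0, ← zpow_add₀ hq0, ← zpow_add₀ hq0]
    congr 1
    push_cast
    ring
  have e2 : q * (q ^ (2 * x ^ 2) * q ^ ((2 * m + 3) * x))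
      = q ^ (x * (x + 1) * (2 : ℕ)) * q ^ (m * x * (2 : ℕ)) * q ^ (x + 1) := by
    rw [← zpow_add₀ hq0, ← zpow_add₀ hq0, ← zpow_add₀ hq0, ← zpow_one_add₀ hq0]
    congr 1
    push_cast
    ring
  have e3 : (c ^ 2) ^ x = c ^ (x * (2 : ℕ)) := by
    rw [← zpow_natCast, ← zpow_mul, mul_comm]
  rw [e3]
  linear_combination c ^ (x * ((2 : ℕ) : ℤ)) * e1 + c * c ^ (x * ((2 : ℕ) : ℤ)) * e2

lemma gFun_eq_sum (hq : 0 < q) (κ : ℂ) (n : ℕ) (x : ℤ) :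
    gFun q κ n x = ∑ i ∈ Finset.range (n + 1),
      kappaSq κ ^ i * q ^ (-(i * ((n : ℤ) - i - 1))) *
        (qPochhammer q q n / (qPochhammer q q i * qPochhammer q q (n - i))) *
      (q ^ (x * (x + 1)) * (-kappaSq κ) ^ x * √(q ^ (-x) + -kappaSq κ * q ^ (x + 1)) *
        q ^ ((2 * (i : ℤ) - n) * x)) := by
  have hq0 := hq.ne'
  unfold gFun
  rw [Finset.mul_sum]
  refine Finset.sum_congr rfl fun i _ => ?_
  have e : q ^ ((2 * (i : ℤ) - n) * x - i * ((n : ℤ) - i - 1))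
      = q ^ ((2 * (i : ℤ) - n) * x) * q ^ (-(i * ((n : ℤ) - i - 1))) := by
    rw [← zpow_add₀ hq0, ← sub_eq_add_neg]
  rw [e, sub_eq_add_neg (q ^ (-x)), ← neg_mul]
  ring

lemma memℓp_gFun (hq : 0 < q) (hq1 : q < 1) {κ : ℂ} (hc : 0 < -kappaSq κ) (n : ℕ) :
    Memℓp (fun x : ℤ => ((gFun q κ n x : ℝ) : ℂ)) 2 := by
  simp_rw [gFun_eq_sum hq]
  push_cast
  refine Memℓp.finsetSum _ fun i _ => ?_
  have := (memℓp_weight hq hq1 hc (2 * (i : ℤ) - n)).const_mul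
    ((kappaSq κ ^ i * q ^ (-(i * ((n : ℤ) - i - 1))) *
        (qPochhammer q q n / (qPochhammer q q i * qPochhammer q q (n - i))) : ℝ) : ℂ)
  push_cast at this
  exact this

lemma gFun_eq_polyPart (hq : 0 < q) (κ : ℂ) (n : ℕ) (x : ℤ) :
    gFun q κ n x = q ^ (x * (x + 1)) * (-kappaSq κ) ^ x * √(q ^ (-x)) * q ^ (-(n * x)) *
      √(1 + -kappaSq κ * q ^ (2 * x + 1)) * polyPart q n (-kappaSq κ * q ^ (2 * x)) := by
  have hq0 := hq.ne'
  have hK : kappaSq κ = -(-kappaSq κ) := by ring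
  rw [gFun_eq_sum hq, polyPart, Finset.mul_sum]
  refine Finset.sum_congr rfl fun i _ => ?_
  rw [polyCoeff, hK]
  generalize -kappaSq κ = c at *
  rw [neg_neg]
  have e1 : q ^ (-x) + c * q ^ (x + 1) = q ^ (-x) * (1 + c * q ^ (2 * x + 1)) := by
    rw [mul_add, mul_left_comm, ← zpow_add₀ hq0]
    ring_nf
  have e2 : q ^ ((2 * (i : ℤ) - n) * x) = q ^ (-(n * x)) * (q ^ (2 * x)) ^ i := by
    rw [← zpow_natCast (q ^ (2 * x)), ← zpow_mul, ← zpow_add₀ hq0]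
    congr 1
    ring
  rw [e1, e2, Real.sqrt_mul (by positivity), mul_pow, neg_pow]
  ring

lemma TCtr_gFun (hq : 0 < q) (hq1 : q < 1) {κ : ℂ} (hc : 0 < -kappaSq κ) (n : ℕ) (x : ℤ) :
    dCtr q κ (x + 1) * gFun q κ n (x + 1) + aCtr q κ x * gFun q κ n x
      + dCtr q κ x * gFun q κ n (x - 1) = q ^ (n + 1) * gFun q κ n x := by
  have hq0 := hq.ne'
  have hd : ∀ x : ℤ, dCtr q κ x = -kappaSq κ * q ^ (2 * x) * √q / ((1 + -kappaSq κ * q ^ (2 * x)) *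
      (√(1 + -kappaSq κ * q ^ (2 * (x - 1) + 1)) * √(1 + -kappaSq κ * q ^ (2 * x + 1)))) := by
    intro x
    have hr : q ^ (2 * (x : ℝ) + 1 / 2) = q ^ (2 * x) * √q := by
      rw [Real.rpow_add hq, ← Real.sqrt_eq_rpow, ← Real.rpow_intCast]
      push_cast
      rfl
    have h1 : 2 * (x - 1) + 1 = 2 * x - 1 := by ring
    rw [dCtr, hr, h1, ← Real.sqrt_mul (by positivity)]
    simp only [neg_mul, sub_eq_add_neg, mul_assoc]
  have ha : aCtr q κ x = -kappaSq κ * (1 + q) * q ^ (2 * x) * q /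
      ((1 + -kappaSq κ * q ^ (2 * x)) * (1 + -kappaSq κ * q ^ (2 * x) * q ^ 2)) := by
    have e1 : q ^ (2 * x + 1) = q ^ (2 * x) * q := zpow_add_one₀ hq0 _
    have e2 : q ^ (2 * x + 2) = q ^ (2 * x) * q ^ 2 := zpow_add₀ hq0 _ 2
    rw [aCtr, e1, e2]
    ring
  simp only [gFun_eq_polyPart hq κ, hd, ha]
  have key := polyPart_qDifference_sq hq hq1 n (-kappaSq κ * q ^ (2 * x))
  generalize -kappaSq κ = c at *
  have hc0 := hc.ne'
  have hs : √q * √q = q := Real.mul_self_sqrt hq.le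
  have hs0 : 0 < √q := Real.sqrt_pos.mpr hq
  have m1 : q ^ ((x + 1) * (x + 1 + 1)) = q ^ (x * (x + 1)) * (q ^ (2 * x) * q ^ 2) := by
    have : (x + 1) * (x + 1 + 1) = x * (x + 1) + (2 * x + 2) := by ring
    rw [this, zpow_add₀ hq0, zpow_add₀ hq0 (2 * x)]; rfl
  have m2 : q ^ ((x - 1) * (x - 1 + 1)) = q ^ (x * (x + 1)) / q ^ (2 * x) := by
    rw [← zpow_sub₀ hq0]; ring_nf
  have m3 : c ^ (x + 1) = c ^ x * c := zpow_add_one₀ hc0 _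
  have m4 : c ^ (x - 1) = c ^ x / c := by rw [zpow_sub_one₀ hc0]; rfl
  have m5 : √(q ^ (-(x + 1))) = √(q ^ (-x)) / √q := by
    rw [← Real.sqrt_div (by positivity), neg_add, zpow_add₀ hq0, zpow_neg_one]; rfl
  have m6 : √(q ^ (-(x - 1))) = √(q ^ (-x)) * √q := by
    rw [← Real.sqrt_mul (by positivity), neg_sub, sub_eq_add_neg, zpow_one_add₀ hq0, mul_comm]
  have m7 : q ^ (-((n : ℤ) * (x + 1))) = q ^ (-((n : ℤ) * x)) / q ^ n := by
    rw [mul_add, neg_add, mul_one, zpow_add₀ hq0, zpow_neg _ (n : ℤ), zpow_natCast]; rfl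
  have m8 : q ^ (-((n : ℤ) * (x - 1))) = q ^ (-((n : ℤ) * x)) * q ^ n := by
    rw [mul_sub, neg_sub, mul_one, sub_eq_add_neg, zpow_add₀ hq0, zpow_natCast, mul_comm]
  have m9 : q ^ (2 * (x + 1)) = q ^ (2 * x) * q ^ 2 := by
    rw [mul_add, zpow_add₀ hq0]; rfl
  have m10 : q ^ (2 * (x - 1)) = q ^ (2 * x) / q ^ 2 := by
    rw [mul_sub, zpow_sub₀ hq0]; rfl
  have m11 : 2 * (x + 1 - 1) + 1 = 2 * x + 1 := by ring
  have p1 : c * (q ^ (2 * x) * q ^ 2) = q ^ 2 * (c * q ^ (2 * x)) := by ring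
  have p2 : c * (q ^ (2 * x) / q ^ 2) = c * q ^ (2 * x) / q ^ 2 := by ring
  rw [m1, m2, m3, m4, m5, m6, m7, m8, m11, m9, m10, p1, p2]
  have t1 : 0 < √(1 + c * q ^ (2 * (x + 1) + 1)) := Real.sqrt_pos.mpr (by positivity)
  have t2 : 0 < √(1 + c * q ^ (2 * (x - 1) + 1)) := Real.sqrt_pos.mpr (by positivity)
  have t0 : 0 < √(1 + c * q ^ (2 * x + 1)) := Real.sqrt_pos.mpr (by positivity)
  have t0' : √(1 + c * q ^ (2 * x + 1)) ^ 2 = 1 + c * q ^ (2 * x) * q := by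
    rw [Real.sq_sqrt (by positivity), zpow_add_one₀ hq0, mul_assoc]
  have hQ : 0 < q ^ (2 * x) := by positivity
  have hN : 0 < q ^ n := by positivity
  rw [pow_succ q n] at key ⊢
  generalize √(1 + c * q ^ (2 * (x + 1) + 1)) = S1 at *
  generalize √(1 + c * q ^ (2 * (x - 1) + 1)) = S2 at *
  generalize √(1 + c * q ^ (2 * x + 1)) = S0 at *
  generalize √(q ^ (-x)) = R at *
  generalize q ^ (-((n : ℤ) * x)) = U at *
  generalize q ^ (x * (x + 1)) = V at *
  generalize c ^ x = C at *
  generalize polyPart q n (q ^ 2 * (c * q ^ (2 * x))) = P1 at *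
  generalize polyPart q n (c * q ^ (2 * x) / q ^ 2) = P2 at *
  generalize polyPart q n (c * q ^ (2 * x)) = P0 at *
  generalize q ^ (2 * x) = Q at *
  generalize q ^ n = N at *
  have d1 : 1 + c * Q ≠ 0 := by positivity
  have d2 : 1 + c * Q * q ^ 2 ≠ 0 := by positivity
  have goal' : c * Q * q ^ 2 * (Q * q ^ 2) * c / (N * (1 + c * Q * q ^ 2)) * P1
      + c * (1 + q) * Q * q / ((1 + c * Q) * (1 + c * Q * q ^ 2)) * (1 + c * Q * q) * P0
      + q * N / (1 + c * Q) * P2 = N * q * (1 + c * Q * q) * P0 := by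
    field_simp
    refine mul_left_cancel₀ hq0 ?_
    linear_combination key
  -- The radicals `S1` and `S2` cancel between `d` and the shifted `g_n`; after the common prefactor
  -- is removed, only `S0 ^ 2` remains, which is rational.
  have hfin : (V * C * R * U / S0) * (c * Q * q ^ 2 * (Q * q ^ 2) * c / (N * (1 + c * Q * q ^ 2)) * P1
      + c * (1 + q) * Q * q / ((1 + c * Q) * (1 + c * Q * q ^ 2)) * S0 ^ 2 * P0
      + q * N / (1 + c * Q) * P2) = (V * C * R * U / S0) * (N * q * S0 ^ 2 * P0) := by
    rw [t0', goal']
  convert hfin using 1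
  · field_simp
    rw [Real.sq_sqrt hq.le]
    ring
  · field_simp

/-- As `x → +∞` the variable `c q^(2x)` tends to `0`, where the polynomial part equals `1`, and the
other factors are positive. -/
lemma exists_gFun_ne_zero (hq : 0 < q) (hq1 : q < 1) {κ : ℂ} (hc : 0 < -kappaSq κ) (n : ℕ) :
    ∃ x, gFun q κ n x ≠ 0 := by
  have h2 : Tendsto (fun k : ℕ => -kappaSq κ * (q ^ 2) ^ k) atTop (𝓝 (-kappaSq κ * 0)) :=
    (tendsto_pow_atTop_nhds_zero_of_lt_one (by positivity)
      (pow_lt_one₀ hq.le hq1 (by norm_num))).const_mul _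
  rw [mul_zero] at h2
  have hcont : Continuous (polyPart q n) := by
    unfold polyPart
    fun_prop
  have h0 : polyPart q n 0 = 1 := by
    rw [polyPart, Finset.sum_range_succ', polyCoeff_zero hq hq1]
    simp
  have ht := (hcont.tendsto 0).comp h2
  rw [h0] at ht
  obtain ⟨k, hk⟩ := (ht.eventually_ne one_ne_zero).exists
  refine ⟨k, ?_⟩
  rw [gFun_eq_polyPart hq κ]
  have e : q ^ (2 * (k : ℤ)) = (q ^ 2) ^ k := by
    rw [← pow_mul, ← zpow_natCast]; push_cast; rfl
  rw [e]
  refine mul_ne_zero ?_ hk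
  have : 0 < √(q ^ (-(k : ℤ))) := Real.sqrt_pos.mpr (by positivity)
  have : 0 < √(1 + -kappaSq κ * q ^ (2 * (k : ℤ) + 1)) := Real.sqrt_pos.mpr (by positivity)
  positivity

end CenterLine
end

/-! ### Completeness by the trace count, and the main theorem. -/

noncomputable section

namespace CenterLine

open Filter Topology

lemma eq_zero_of_orthogonal_eigenvectors {q c : ℝ} (hq : 0 < q) (hq1 : q < 1) (hc : 0 < c)
    {g : ℕ → EllTwo} (hg0 : ∀ n, g n ≠ 0)
    (hT : ∀ n, sumRankOne (rowVec q c) (g n) = ((q : ℂ) ^ (n + 1)) • g n)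
    (horth : ∀ m n, m ≠ n → inner ℂ (g m) (g n) = 0) {v : EllTwo}
    (hv : ∀ n, inner ℂ (g n) v = 0) : v = 0 := by
  refine eq_zero_of_inner_rowVec hq hq1 hc fun x => ?_
  set e : ℕ → EllTwo := fun n => ((‖g n‖⁻¹ : ℝ) : ℂ) • g n with he
  have hon : Orthonormal ℂ e := by
    constructor
    · intro n
      have := norm_ne_zero_iff.mpr (hg0 n)
      rw [he, norm_smul, Complex.norm_real, norm_inv, norm_norm, inv_mul_cancel₀ this]
    · intro m n hmn
      simp [he, inner_smul_left, inner_smul_right, horth m n hmn]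
  -- The eigenvalue sum equals the trace of `T`; this equality forces completeness.
  have hgeom : HasSum (fun n : ℕ => q ^ (n + 1)) (q / (1 - q)) := by
    simpa [pow_succ', div_eq_mul_inv] using (hasSum_geometric_of_lt_one hq.le hq1).mul_left q
  refine inner_eq_zero_of_trace_le (summable_norm_sq_rowVec hq hq1 hc) hon
    (l := fun n => q ^ (n + 1)) (fun n => ?_) hgeom ?_ (fun n => ?_) x
  · rw [he]
    simp only [map_smul, hT]
    rw [smul_comm]
    push_cast
    rfl
  · simp_rw [norm_sq_rowVec hq hc]
    exact (hasSum_alphaSq_add_betaSq hq hq1 hc).tsum_eq.le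
  · simp [he, hv]

lemma neg_kappaSq_pos {κ : ℂ} (hre : κ.re = 0) (h0 : κ ≠ 0) : 0 < -kappaSq κ := by
  have him : κ.im ≠ 0 := fun h => h0 (Complex.ext hre h)
  have : -kappaSq κ = κ.im ^ 2 := by simp [kappaSq, sq, hre]
  rw [this]
  positivity

end CenterLine
end

theorem proposition4p2 (q : ℝ) (hq0 : 0 < q) (hq1 : q < 1)
    (κ : ℂ) (hκre : κ.re = 0) (hκ0 : κ ≠ 0) :
    ∃ (T : CenterLine.EllTwo →L[ℂ] CenterLine.EllTwo) (g : ℕ → CenterLine.EllTwo),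
      -- `T` is the bounded operator given by the difference expression; it is self-adjoint
      (∀ (f : CenterLine.EllTwo) (x : ℤ), T f x = CenterLine.TCtr q κ (fun y => f y) x) ∧
      IsSelfAdjoint T ∧
      -- the functions `g_n` belong to `ℓ²(ℤ)`
      (∀ (n : ℕ) (x : ℤ), g n x = ((CenterLine.gFun q κ n x : ℝ) : ℂ)) ∧
      -- they are (nonzero) eigenfunctions, with eigenvalues `q^(n+1)`
      (∀ n : ℕ, g n ≠ 0 ∧ T (g n) = ((q : ℂ) ^ (n + 1)) • g n) ∧
      -- they form an orthogonal basis
      (∀ m n : ℕ, m ≠ n → inner ℂ (g m) (g n) = 0) ∧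
      (Submodule.span ℂ (Set.range g)).topologicalClosure = ⊤ ∧
      -- positivity: the eigenvalues are exactly the `q^(n+1)` (so `0` is not one), `T` is strictly
      -- positive, and the spectrum consists of the eigenvalues and their accumulation point `0`
      (∀ μ : ℂ, Module.End.HasEigenvalue (T : Module.End ℂ CenterLine.EllTwo) μ ↔
        ∃ n : ℕ, μ = (q : ℂ) ^ (n + 1)) ∧
      (∀ f : CenterLine.EllTwo, f ≠ 0 → 0 < (inner ℂ (T f) f).re) ∧
      spectrum ℂ T = insert 0 (Set.range fun n : ℕ => (q : ℂ) ^ (n + 1)) := by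
  have hc := CenterLine.neg_kappaSq_pos hκre hκ0
  have hw := CenterLine.summable_norm_sq_rowVec hq0 hq1 hc
  set T := sumRankOne (CenterLine.rowVec q (-CenterLine.kappaSq κ)) with hTdef
  set g : ℕ → CenterLine.EllTwo := fun n => ⟨_, CenterLine.memℓp_gFun hq0 hq1 hc n⟩ with hgdef
  have hTapp : ∀ (f : CenterLine.EllTwo) (x : ℤ),
      T f x = CenterLine.TCtr q κ (fun y => f y) x :=
    CenterLine.sumRankOne_rowVec_apply hq0 hq1 hc
  have hgapp : ∀ (n : ℕ) (x : ℤ), g n x = ((CenterLine.gFun q κ n x : ℝ) : ℂ) := fun _ _ => rfl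
  have hsa : IsSelfAdjoint T := isSelfAdjoint_sumRankOne hw
  have hsymm : ∀ f h, inner ℂ (T f) h = inner ℂ f (T h) :=
    ContinuousLinearMap.isSelfAdjoint_iff_isSymmetric.mp hsa
  have hcpt : IsCompactOperator T := isCompactOperator_sumRankOne hw
  have hg0 : ∀ n, g n ≠ 0 := by
    intro n h
    obtain ⟨x, hx⟩ := CenterLine.exists_gFun_ne_zero hq0 hq1 hc n
    have h' := hgapp n x
    rw [h] at h'
    exact hx (Complex.ofReal_eq_zero.mp h'.symm)
  have hTg : ∀ n, T (g n) = ((q : ℂ) ^ (n + 1)) • g n := by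
    intro n
    ext x
    rw [hTapp, lp.coeFn_smul, Pi.smul_apply, smul_eq_mul, CenterLine.TCtr]
    simp only [hgapp]
    exact_mod_cast CenterLine.TCtr_gFun hq0 hq1 hc n x
  -- Used twice: for orthogonality of the `g n`, and to show that an eigenvector for any other
  -- eigenvalue would be orthogonal to all of them.
  have hinner : ∀ (n : ℕ) (μ : ℂ) (v : CenterLine.EllTwo), T v = μ • v →
      μ ≠ (q : ℂ) ^ (n + 1) → inner ℂ (g n) v = 0 := by
    intro n μ v hv hμ
    have h := hsymm (g n) v
    rw [hTg, hv, inner_smul_left, inner_smul_right, map_pow, Complex.conj_ofReal] at h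
    have h' : (μ - (q : ℂ) ^ (n + 1)) * inner ℂ (g n) v = 0 := by rw [sub_mul, h, sub_self]
    exact (mul_eq_zero.mp h').resolve_left (sub_ne_zero.mpr hμ)
  have horth : ∀ m n : ℕ, m ≠ n → inner ℂ (g m) (g n) = 0 := by
    intro m n hmn
    refine hinner m _ (g n) (hTg n) fun h => hmn ?_
    have h' : q ^ (n + 1) = q ^ (m + 1) := by exact_mod_cast h
    have := pow_right_injective₀ hq0 hq1.ne h'
    omega
  have hcomplete : ∀ v : CenterLine.EllTwo, (∀ n, inner ℂ (g n) v = 0) → v = 0 := fun v hv =>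
    CenterLine.eq_zero_of_orthogonal_eigenvectors hq0 hq1 hc hg0 hTg horth hv
  have heig : ∀ μ : ℂ, Module.End.HasEigenvalue (T : Module.End ℂ CenterLine.EllTwo) μ ↔
      ∃ n : ℕ, μ = (q : ℂ) ^ (n + 1) := by
    intro μ
    constructor
    · intro h
      obtain ⟨v, hv⟩ := h.exists_hasEigenvector
      by_contra! hne
      exact hv.2 (hcomplete v fun n => hinner n μ v hv.apply_eq_smul (hne n))
    · rintro ⟨n, rfl⟩
      exact Module.End.hasEigenvalue_of_hasEigenvector
        (Module.End.hasEigenvector_iff.mpr ⟨Module.End.mem_eigenspace_iff.mpr (hTg n), hg0 n⟩)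
  refine ⟨T, g, hTapp, hsa, hgapp, fun n => ⟨hg0 n, hTg n⟩, horth, ?_, heig, ?_, ?_⟩
  · rw [Submodule.topologicalClosure_eq_top_iff, Submodule.eq_bot_iff]
    intro v hv
    exact hcomplete v fun n =>
      (Submodule.mem_orthogonal _ _).mp hv _ (Submodule.subset_span ⟨n, rfl⟩)
  · intro f hf
    have hs := hasSum_re_inner_sumRankOne hw f
    refine lt_of_le_of_ne (hs.nonneg fun _ => by positivity) fun h0 => hf ?_
    rw [← h0, hasSum_zero_iff_of_nonneg (fun _ => by positivity)] at hs
    refine CenterLine.eq_zero_of_inner_rowVec hq0 hq1 hc fun x => ?_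
    simpa using congrFun hs x
  · have hmem : ∀ n : ℕ, (q : ℂ) ^ (n + 1) ∈ spectrum ℂ T := by
      intro n
      have hne : (q : ℂ) ^ (n + 1) ≠ 0 := pow_ne_zero _ (by exact_mod_cast hq0.ne')
      exact (hcpt.hasEigenvalue_iff_mem_spectrum hne).mp ((heig _).mpr ⟨n, rfl⟩)
    ext μ
    simp only [Set.mem_insert_iff, Set.mem_range]
    constructor
    · intro hμ
      by_cases h0 : μ = 0
      · exact Or.inl h0
      · obtain ⟨n, hn⟩ := (heig μ).mp ((hcpt.hasEigenvalue_iff_mem_spectrum h0).mpr hμ)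
        exact Or.inr ⟨n, hn.symm⟩
    · rintro (rfl | ⟨n, rfl⟩)
      -- Zero is not an eigenvalue; it enters the closed spectrum as the limit of `q^(n+1)`.
      · have hlim : Filter.Tendsto (fun n : ℕ => (q : ℂ) ^ (n + 1)) Filter.atTop (nhds 0) :=
          (tendsto_pow_atTop_nhds_zero_of_norm_lt_one
            (by rwa [Complex.norm_real, Real.norm_of_nonneg hq0.le])).comp
              (Filter.tendsto_add_atTop_nat 1)
        exact (spectrum.isClosed T).mem_of_tendsto hlim (Filter.Eventually.of_forall hmem)
      · exact hmem n
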